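/- Let $n\ge 1$ and let $\mathcal T_n$ be a polynomial of degree exactly $n$ with complex coefficients. Put $\mathcal T_n^{-1}([-1,1]):=\{z\in\mathbb C:\mathcal T_n(z)\in[-1,1]\}$, and let $T_n$ denote the classical Chebyshev polynomial of the first kind, $T_n(\cos\theta)=\cos(n\theta)$. A set $S\subset\mathbb C$ is a Jordan arc with endpoints $a,b$ if $S=\gamma([0,1])$ for some continuous injective $\gamma:[0,1]\to\mathbb C$ with $\gamma(0)=a$, $\gamma(1)=b$. (i) Let $a_1,a_2\in\mathbb C$, $a_1\ne a_2$. Then $\mathcal T_n^{-1}([-1,1])$ is a Jordan arc with endpoints $a_1,a_2$ if and only if either $$\mathcal T_n(z)=T_n\Bigl(\frac{2z-a_1-a_2}{a_2-a_1}\Bigr)\ \text{ for all } z\in\mathbb C,\qquad\text{or}\qquad \mathcal T_n(z)=-T_n\Bigl(\frac{2z-a_1-a_2}{a_2-a_1}\Bigr)\ \text{ for all } z\in\mathbb C.$$ In this case $\mathcal T_n^{-1}([-1,1])$ is the line segment $[a_1,a_2]=\{(1-t)a_1+ta_2:0\le t\le 1\}$. (ii) Let $\ell\ge 1$ and let $a_1<a_2<\dots<a_{2\ell}$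 be real numbers. Then $$\mathcal T_n^{-1}([-1,1])=[a_1,a_2]\cup[a_3,a_4]\cup\dots\cup[a_{2\ell-1},a_{2\ell}]$$ if and only if $\ell\le n$ and there is a polynomial $\mathcal U_{n-\ell}$ of degree $n-\ell$ with complex coefficients and with the same leading coefficient as $\mathcal T_n$ such that $$\mathcal T_n(z)^2-1=\mathcal H_{2\ell}(z)\,\mathcal U_{n-\ell}(z)^2,\qquad \mathcal H_{2\ell}(z)=\prod_{j=1}^{2\ell}(z-a_j).$$ -/

import Mathlib

open Polynomial

/-- The inverse image `{z ∈ ℂ : P(z) ∈ [-1, 1]}`. -/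
def polyInvImage (P : ℂ[X]) : Set ℂ :=
  {z | ∃ t : ℝ, t ∈ Set.Icc (-1 : ℝ) 1 ∧ P.eval z = (t : ℂ)}

/-- `S` is a Jordan arc with endpoints `a` and `b`: the image of an injective continuous
path from `a` to `b`. -/
def IsJordanArc (S : Set ℂ) (a b : ℂ) : Prop :=
  ∃ γ : Path a b, Function.Injective γ ∧ Set.range γ = S

/-- The monic polynomial `H(z) = ∏ j, (z - a j)` of degree `2 * ℓ`. -/
noncomputable def pellH {ℓ : ℕ} (a : Fin (2 * ℓ) → ℂ) : ℂ[X] :=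
  ∏ j, (X - C (a j))

/-- `P ^ 2 - 1 = H * U ^ 2`, where `U` has degree `deg P - ℓ` and the same leading
coefficient as `P`. -/
def SatisfiesPell {ℓ : ℕ} (P : ℂ[X]) (a : Fin (2 * ℓ) → ℂ) : Prop :=
  ∃ U : ℂ[X], U.natDegree + ℓ = P.natDegree ∧ U.leadingCoeff = P.leadingCoeff ∧
    P ^ 2 - 1 = pellH a * U ^ 2

/-- The union `[a 0, a 1] ∪ [a 2, a 3] ∪ … ∪ [a (2ℓ-2), a (2ℓ-1)]` of real intervals, as a
subset of `ℂ`. -/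
def intervalUnion {ℓ : ℕ} (a : Fin (2 * ℓ) → ℝ) : Set ℂ :=
  ⋃ j : Fin ℓ, (fun x : ℝ => (x : ℂ)) ''
    Set.Icc (a ⟨2 * j, by omega⟩) (a ⟨2 * j + 1, by omega⟩)

/-! Both parts go through the Pell equation `P ^ 2 - 1 = H * U ^ 2`, which holds as soon as the
zeros of odd order of `P ^ 2 - 1` are exactly the simple zeros of `H`
(`satisfiesPell_of_odd_rootMultiplicity`).

For real intervals, `P` is real on the line and `P ^ 2 - 1` changes sign exactly at the endpoints,
which gives the parity. Conversely, the equation gives `P ^ 2 ≤ 1` on the intervals, and a maximum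
modulus argument for `P - U * √H`, an inverse Joukowski image of `P`, excludes further points of the
inverse image (`polyInvImage_subset_of_sqrt`).

For a Jordan arc, `P` cannot take a value `±1` simply at an interior point
(`rootMultiplicity_ne_one_of_path`). So `P ^ 2 - 1` has at most two simple zeros, and counting
critical points forces the endpoints to be simple and all other zeros double. The Chebyshev
polynomial of the segment solves the same Pell equation in the same degree, and such solutions are
unique up to sign (`pell_unique`). -/

/-! ### Uniqueness for the polynomial Pell equation -/

/-- Solutions of the polynomial Pell equation of a given degree are unique up to sign. -/
theorem pell_unique {H P₁ P₂ U₁ U₂ : ℂ[X]} (hH : 0 < H.natDegree)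
    (hdeg : P₁.natDegree = P₂.natDegree) (hpos : 0 < P₁.natDegree)
    (h₁ : P₁ ^ 2 - 1 = H * U₁ ^ 2) (h₂ : P₂ ^ 2 - 1 = H * U₂ ^ 2) :
    P₁ = P₂ ∨ P₁ = -P₂ := by
  rw [← sq_eq_sq_iff_eq_or_eq_neg]
  have hP₁ : P₁ ≠ 0 := ne_zero_of_natDegree_gt hpos
  have hP₂ : P₂ ≠ 0 := ne_zero_of_natDegree_gt (hdeg ▸ hpos)
  have hH0 : H ≠ 0 := ne_zero_of_natDegree_gt hH
  -- If one of the two products of fundamental solutions is constant, we are done.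
  have key : ∀ U₂' : ℂ[X], P₂ ^ 2 - 1 = H * U₂' ^ 2 →
      (P₁ * P₂ - H * U₁ * U₂').natDegree = 0 → P₁ ^ 2 = P₂ ^ 2 := by
    intro V hV hA
    -- Brahmagupta composition: this is the quotient of `P₁ + U₁√H` by `P₂ + V√H`. A constant first
    -- component kills the second one, as `H` has positive degree.
    have hpell : (P₁ * P₂ - H * U₁ * V) ^ 2 - 1 = H * (U₁ * P₂ - V * P₁) ^ 2 := by
      linear_combination (P₂ ^ 2 - H * V ^ 2) * h₁ + hV
    have hB : U₁ * P₂ - V * P₁ = 0 := by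
      by_contra hne
      have hd := congrArg natDegree hpell
      rw [natDegree_mul hH0 (pow_ne_zero 2 hne)] at hd
      have hle : ((P₁ * P₂ - H * U₁ * V) ^ 2 - 1).natDegree ≤ 0 := by
        refine (natDegree_sub_le _ _).trans ?_
        simp [natDegree_pow, hA]
      omega
    linear_combination H * (U₁ * P₂ + V * P₁) * hB - P₁ ^ 2 * hV + P₂ ^ 2 * h₁
  have hprod : (P₁ * P₂ - H * U₁ * U₂) * (P₁ * P₂ + H * U₁ * U₂) = P₁ ^ 2 + P₂ ^ 2 - 1 := by
    linear_combination P₁ ^ 2 * h₂ + H * U₂ ^ 2 * h₁ - h₂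
  have hbound : (P₁ ^ 2 + P₂ ^ 2 - 1).natDegree ≤ 2 * P₁.natDegree := by
    refine (natDegree_sub_le _ _).trans ?_
    simp only [natDegree_one, Nat.max_zero]
    refine (natDegree_add_le _ _).trans ?_
    simp [natDegree_pow, hdeg]
  -- The two factors add up to `2 * P₁ * P₂`, so one has degree at least `2 * deg P₁`. Their product
  -- has at most that degree, so if both are nonzero the other is constant.
  have hsum : 2 * P₁.natDegree ≤
      max (P₁ * P₂ - H * U₁ * U₂).natDegree (P₁ * P₂ + H * U₁ * U₂).natDegree := by
    refine le_trans (le_of_eq ?_) (natDegree_add_le _ _)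
    have : P₁ * P₂ - H * U₁ * U₂ + (P₁ * P₂ + H * U₁ * U₂) = C 2 * (P₁ * P₂) := by
      rw [show (C 2 : ℂ[X]) = 2 from rfl]; ring
    rw [this, natDegree_C_mul two_ne_zero, natDegree_mul hP₁ hP₂]
    omega
  by_cases hA : P₁ * P₂ - H * U₁ * U₂ = 0
  · exact key U₂ h₂ (by simp [hA])
  by_cases hA' : P₁ * P₂ + H * U₁ * U₂ = 0
  · refine key (-U₂) (by simpa using h₂) ?_
    rw [mul_neg, sub_neg_eq_add, hA', natDegree_zero]
  rw [← hprod, natDegree_mul hA hA'] at hbound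
  rcases le_max_iff.1 hsum with h | h
  · refine key (-U₂) (by simpa using h₂) ?_
    rw [mul_neg, sub_neg_eq_add]
    omega
  · exact key U₂ h₂ (by omega)

/-! ### Parity of multiplicities and the Pell equation -/

/-- A polynomial whose roots of odd multiplicity are the points of `A` is, up to a constant,
the product of the monic polynomial with simple zeros on `A` and a square. -/
theorem exists_eq_prod_mul_sq {f : ℂ[X]} {A : Finset ℂ}
    (hA : ∀ r, Odd (f.rootMultiplicity r) ↔ r ∈ A) :
    ∃ V : ℂ[X], V.Monic ∧ f = C f.leadingCoeff * (∏ r ∈ A, (X - C r)) * V ^ 2 := by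
  classical
  refine ⟨∏ r ∈ f.roots.toFinset, (X - C r) ^ (f.rootMultiplicity r / 2),
    monic_prod_of_monic _ _ fun r _ => (monic_X_sub_C r).pow _, ?_⟩
  rcases eq_or_ne f 0 with rfl | hf
  · simp
  conv_lhs => rw [(IsAlgClosed.splits f).eq_prod_roots, prod_multiset_root_eq_finset_root]
  have hsub : A ⊆ f.roots.toFinset := by
    intro r hr
    rw [Multiset.mem_toFinset, mem_roots hf, ← rootMultiplicity_pos hf]
    exact ((hA r).2 hr).pos
  rw [mul_assoc]
  congr 1
  rw [← Finset.prod_pow, ← Finset.inter_eq_right.2 hsub, ← Finset.prod_ite_mem,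
    ← Finset.prod_mul_distrib]
  refine Finset.prod_congr rfl fun r _ => ?_
  rw [← pow_mul]
  split_ifs with h
  · rw [← pow_succ']
    congr 1
    have := (hA r).2 h
    grind
  · rw [one_mul]
    congr 1
    have := mt (hA r).1 h
    grind

theorem natDegree_sq_sub_one (P : ℂ[X]) : (P ^ 2 - 1).natDegree = 2 * P.natDegree := by
  rw [← C_1, natDegree_sub_C, natDegree_pow]

theorem leadingCoeff_sq_sub_one {P : ℂ[X]} (hP : 0 < P.natDegree) :
    (P ^ 2 - 1).leadingCoeff = P.leadingCoeff ^ 2 := by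
  rw [leadingCoeff_sub_of_degree_lt, leadingCoeff_pow]
  rw [degree_one, ← natDegree_pos_iff_degree_pos, natDegree_pow]
  omega

theorem pellH_natDegree {ℓ : ℕ} (a : Fin (2 * ℓ) → ℂ) : (pellH a).natDegree = 2 * ℓ := by
  simp [pellH, natDegree_prod_of_monic _ _ fun j _ => monic_X_sub_C (a j)]

theorem pellH_ne_zero {ℓ : ℕ} (a : Fin (2 * ℓ) → ℂ) : pellH a ≠ 0 :=
  (monic_prod_of_monic _ _ fun j _ => monic_X_sub_C (a j)).ne_zero

/-- The Pell equation is equivalent to a parity condition on the zeros of `P ^ 2 - 1`. -/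
theorem satisfiesPell_of_odd_rootMultiplicity {ℓ : ℕ} {P : ℂ[X]} (hP : 0 < P.natDegree)
    {a : Fin (2 * ℓ) → ℂ} (ha : Function.Injective a)
    (h : ∀ r, Odd ((P ^ 2 - 1).rootMultiplicity r) ↔ r ∈ Set.range a) : SatisfiesPell P a := by
  classical
  obtain ⟨V, hV, hf⟩ := exists_eq_prod_mul_sq (f := P ^ 2 - 1) (A := Finset.univ.image a)
    (by simpa using h)
  rw [Finset.prod_image ha.injOn, leadingCoeff_sq_sub_one hP] at hf
  change _ = _ * pellH a * V ^ 2 at hf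
  have hP0 : P ≠ 0 := ne_zero_of_natDegree_gt hP
  have hlc : P.leadingCoeff ≠ 0 := leadingCoeff_ne_zero.2 hP0
  have hd := congrArg natDegree hf
  rw [natDegree_sq_sub_one, mul_assoc, natDegree_C_mul (pow_ne_zero 2 hlc),
    natDegree_mul (pellH_ne_zero a) (pow_ne_zero 2 hV.ne_zero), pellH_natDegree,
    natDegree_pow] at hd
  refine ⟨C P.leadingCoeff * V, ?_, ?_, ?_⟩
  · rw [natDegree_C_mul hlc]
    omega
  · rw [leadingCoeff_mul, hV.leadingCoeff, leadingCoeff_C, mul_one]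
  · rw [hf, C_pow]
    ring

/-! ### The maximum modulus argument -/

open Filter Topology Bornology

/-- Minimum principle for the Joukowski preimage: if `q` is a square root of `P ^ 2 - 1`, holomorphic
off the closed set `E`, such that `P - q` is bounded by one near infinity, and `P` maps `E` to
`[-1, 1]`, then `E` contains the whole inverse image of `[-1, 1]`. -/
theorem polyInvImage_subset_of_sqrt {P : ℂ[X]} (hP : 0 < P.natDegree) {E : Set ℂ}
    (hE : IsClosed E) (hEP : E ⊆ polyInvImage P) {q : ℂ → ℂ} (hq : DifferentiableOn ℂ q Eᶜ)
    (hsq : ∀ z ∉ E, q z ^ 2 = P.eval z ^ 2 - 1)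
    (hinf : ∀ᶠ z in cobounded ℂ, ‖P.eval z - q z‖ ≤ 1) : polyInvImage P ⊆ E := by
  have hmul : ∀ z ∉ E, (P.eval z - q z) * (P.eval z + q z) = 1 := fun z hz => by
    linear_combination -hsq z hz
  -- With `w = P - q`, `P = (w + w⁻¹) / 2`, so level sets of `‖w‖` map into ellipses with foci `±1`.
  -- The focal sum, unlike `q`, is continuous across `E`.
  have hJ : ∀ z ∉ E, ‖P.eval z - q z‖ + ‖P.eval z - q z‖⁻¹ =
      ‖P.eval z - 1‖ + ‖P.eval z + 1‖ := by
    intro z hz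
    set w := P.eval z - q z with hw
    have hw0 : w ≠ 0 := left_ne_zero_of_mul_eq_one (hmul z hz)
    have hPz : P.eval z = (w + w⁻¹) / 2 := by
      rw [inv_eq_of_mul_eq_one_right (hmul z hz), hw]; ring
    have h1 : P.eval z - 1 = (w - 1) ^ 2 / (2 * w) := by rw [hPz]; field_simp; ring
    have h2 : P.eval z + 1 = (w + 1) ^ 2 / (2 * w) := by rw [hPz]; field_simp; ring
    have hn : ‖w‖ ≠ 0 := norm_ne_zero_iff.2 hw0
    rw [h1, h2, norm_div, norm_div, norm_pow, norm_pow, norm_mul, Complex.norm_two]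
    have := parallelogram_law_with_norm ℝ w 1
    rw [norm_one] at this
    field_simp
    linear_combination -this
  have hEJ : ∀ z ∈ polyInvImage P, ‖P.eval z - 1‖ + ‖P.eval z + 1‖ = 2 := by
    rintro z ⟨t, ⟨h1, h2⟩, ht⟩
    rw [ht, ← Complex.ofReal_one, ← Complex.ofReal_sub, ← Complex.ofReal_add, Complex.norm_real,
      Complex.norm_real, Real.norm_of_nonpos (by linarith), Real.norm_of_nonneg (by linarith)]
    ring
  have hcont : Continuous fun z => ‖P.eval z - 1‖ + ‖P.eval z + 1‖ := by fun_prop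
  have hdiff : DifferentiableOn ℂ (fun z => P.eval z - q z) Eᶜ :=
    P.differentiable.differentiableOn.sub hq
  have hle : ∀ z ∉ E, ‖P.eval z - q z‖ ≤ 1 := by
    intro z₀ hz₀
    by_contra! hlt
    set c := (1 + ‖P.eval z₀ - q z₀‖) / 2 with hc
    have hc1 : 1 < c := by rw [hc]; linarith
    set W := Eᶜ ∩ {z | c < ‖P.eval z - q z‖} with hW
    have hWopen : IsOpen W := by
      refine hdiff.continuousOn.norm.isOpen_inter_preimage hE.isOpen_compl isOpen_Ioi
    -- On `W` the focal sum is at least `c + c⁻¹ > 2`, while on `E` it equals `2`; so the closure of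
    -- `W` does not touch `E`.
    have hclos : closure W ⊆ Eᶜ ∩ {z | c ≤ ‖P.eval z - q z‖} := by
      have hnot : ∀ z ∈ closure W, z ∉ E := by
        have : closure W ⊆ {z | c + c⁻¹ ≤ ‖P.eval z - 1‖ + ‖P.eval z + 1‖} := by
          refine closure_minimal ?_ (isClosed_le continuous_const hcont)
          rintro z ⟨hz, hcz⟩
          simp only [Set.mem_ofPred_eq] at hcz ⊢
          rw [← hJ z hz]
          have hpos : 0 < ‖P.eval z - q z‖ := by linarith
          rw [← sub_nonneg]
          have : ‖P.eval z - q z‖ + ‖P.eval z - q z‖⁻¹ - (c + c⁻¹) =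
              (‖P.eval z - q z‖ - c) * (‖P.eval z - q z‖ * c - 1) / (‖P.eval z - q z‖ * c) := by
            field_simp
            ring
          rw [this]
          have : 1 ≤ ‖P.eval z - q z‖ * c := by nlinarith
          apply div_nonneg (mul_nonneg _ _) <;> linarith
        intro z hz hzE
        have h := this hz
        simp only [Set.mem_ofPred_eq] at h
        rw [hEJ z (hEP hzE)] at h
        have : 0 < (c - 1) ^ 2 / c := by
          have : 0 < c - 1 := by linarith
          positivity
        have h' : (c - 1) ^ 2 / c = c + c⁻¹ - 2 := by field_simp; ring
        linarith
      intro z hz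
      refine ⟨hnot z hz, ?_⟩
      have hca : ContinuousAt (fun z => ‖P.eval z - q z‖) z :=
        (hdiff.differentiableAt (hE.isOpen_compl.mem_nhds (hnot z hz))).continuousAt.norm
      have : (𝓝[W] z).NeBot := mem_closure_iff_nhdsWithin_neBot.1 hz
      exact ge_of_tendsto (hca.tendsto.mono_left nhdsWithin_le_nhds)
        (eventually_nhdsWithin_of_forall fun y (hy : y ∈ W) => le_of_lt hy.2)
    have hbdd : IsBounded W := by
      rw [isBounded_def]
      filter_upwards [hinf] with z hz hzW
      have := hzW.2
      simp only [Set.mem_ofPred_eq] at this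
      linarith
    have hdcc : DiffContOnCl ℂ (fun z => P.eval z - q z) W :=
      (hdiff.mono fun z hz => (hclos hz).1).diffContOnCl
    have hfr : ∀ z ∈ frontier W, ‖P.eval z - q z‖ ≤ c := by
      intro z hz
      rw [hWopen.frontier_eq] at hz
      by_contra! hlt'
      exact hz.2 ⟨(hclos hz.1).1, hlt'⟩
    have := Complex.norm_le_of_forall_mem_frontier_norm_le hbdd hdcc hfr
      (subset_closure (show z₀ ∈ W from ⟨hz₀, by simp only [Set.mem_ofPred_eq]; rw [hc]; linarith⟩))
    rw [hc] at this
    linarith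
  intro z₀ hz₀
  by_contra hz₀E
  have h1 : ‖P.eval z₀ - q z₀‖ = 1 := by
    have h := hJ z₀ hz₀E
    rw [hEJ z₀ hz₀] at h
    have hpos : 0 < ‖P.eval z₀ - q z₀‖ :=
      norm_pos_iff.2 (left_ne_zero_of_mul_eq_one (hmul z₀ hz₀E))
    field_simp at h
    nlinarith
  have hnhds : Eᶜ ∈ 𝓝 z₀ := hE.isOpen_compl.mem_nhds hz₀E
  have hconst := Complex.eventually_eq_of_isLocalMax_norm (f := fun z => P.eval z - q z) (c := z₀)
    (by
      filter_upwards [hE.isOpen_compl.mem_nhds hz₀E] with z hz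
      exact hdiff.differentiableAt (hE.isOpen_compl.mem_nhds hz))
    (by
      filter_upwards [hnhds] with z hz
      simpa [h1] using hle z hz)
  -- If `P - q` is locally constant, so is its inverse `P + q`, hence also their mean `P`.
  have hPconst : ∀ᶠ z in 𝓝 z₀, P.eval z = (C (P.eval z₀)).eval z := by
    filter_upwards [hconst, hnhds] with z hz hzE
    have h2 := hmul z hzE
    have h3 := hmul z₀ hz₀E
    rw [hz] at h2
    have h4 := mul_left_cancel₀ (left_ne_zero_of_mul_eq_one h3) (h2.trans h3.symm)
    rw [eval_C]
    linear_combination (hz + h4) / 2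
  have := eq_of_infinite_eval_eq P (C (P.eval z₀)) (infinite_of_mem_nhds z₀ hPconst)
  rw [this, natDegree_C] at hP
  exact hP.false

/-! ### The square root of `H` off the intervals -/

theorem prod_fin_two_mul {M : Type*} [CommMonoid M] (ℓ : ℕ) (f : Fin (2 * ℓ) → M) :
    ∏ i, f i = ∏ j : Fin ℓ, f ⟨2 * j, by omega⟩ * f ⟨2 * j + 1, by omega⟩ := by
  induction ℓ with
  | zero => simp
  | succ ℓ ih =>
    rw [Fin.prod_univ_castSucc (n := ℓ), show (∏ i, f i) = ∏ i : Fin (2 * ℓ + 1 + 1), f i from rfl,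
      Fin.prod_univ_castSucc, Fin.prod_univ_castSucc, ih, mul_assoc]
    rfl

theorem mem_intervalUnion {ℓ : ℕ} {a : Fin (2 * ℓ) → ℝ} {z : ℂ} :
    z ∈ intervalUnion a ↔ ∃ j : Fin ℓ, ∃ x : ℝ,
      x ∈ Set.Icc (a ⟨2 * j, by omega⟩) (a ⟨2 * j + 1, by omega⟩) ∧ (x : ℂ) = z := by
  simp only [intervalUnion, Set.mem_iUnion, Set.mem_image]

theorem isClosed_intervalUnion {ℓ : ℕ} (a : Fin (2 * ℓ) → ℝ) : IsClosed (intervalUnion a) :=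
  isClosed_iUnion_of_finite fun _ => (isCompact_Icc.image Complex.continuous_ofReal).isClosed

theorem ofReal_mem_intervalUnion {ℓ : ℕ} {a : Fin (2 * ℓ) → ℝ} {x : ℝ} :
    (x : ℂ) ∈ intervalUnion a ↔ ∃ j : Fin ℓ,
      x ∈ Set.Icc (a ⟨2 * j, by omega⟩) (a ⟨2 * j + 1, by omega⟩) := by
  simp [mem_intervalUnion]

theorem tendsto_eval_div_pow (P : ℂ[X]) :
    Tendsto (fun z : ℂ => P.eval z / z ^ P.natDegree) (cobounded ℂ) (𝓝 P.leadingCoeff) := by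
  have h : Tendsto (fun z : ℂ => P.reverse.eval z⁻¹) (cobounded ℂ) (𝓝 (P.reverse.eval 0)) :=
    (P.reverse.continuous.tendsto 0).comp tendsto_inv₀_cobounded
  rw [← coeff_zero_eq_eval_zero, coeff_zero_reverse] at h
  refine h.congr' ?_
  filter_upwards [eventually_ne_cobounded (0 : ℂ)] with z hz
  let := invertibleOfNonzero hz
  have := eval₂_reverse_mul_pow (RingHom.id ℂ) z P
  rw [invOf_eq_inv] at this
  change P.reverse.eval z⁻¹ * _ = P.eval z at this
  rw [eq_div_iff (pow_ne_zero _ hz), this]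

theorem tendsto_sub_div_self (a : ℂ) :
    Tendsto (fun z : ℂ => (z - a) / z) (cobounded ℂ) (𝓝 1) := by
  have h := tendsto_eval_div_pow (X - C a)
  simp only [natDegree_X_sub_C, leadingCoeff_X_sub_C, pow_one] at h
  simpa using h

theorem tendsto_sub_div_sub (a b : ℂ) :
    Tendsto (fun z : ℂ => (z - b) / (z - a)) (cobounded ℂ) (𝓝 1) := by
  have := (tendsto_sub_div_self b).div (tendsto_sub_div_self a) one_ne_zero
  rw [div_one] at this
  refine this.congr' ?_
  filter_upwards [eventually_ne_cobounded (0 : ℂ)] with z hz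
  simp only [Pi.div_apply]
  rw [div_div_div_cancel_right₀ hz]

/-- The Möbius map `z ↦ (z - b) / (z - a)` takes a value `r ≤ 0` only at `(b - r * a) / (1 - r)`, a
convex combination of `a` and `b`. Thus the principal square root of the quotient is holomorphic off
`[a, b]`. -/
theorem sub_div_sub_mem_slitPlane {a b : ℝ} (hab : a < b) {z : ℂ}
    (hz : ∀ x ∈ Set.Icc a b, (x : ℂ) ≠ z) : (z - b) / (z - a) ∈ Complex.slitPlane := by
  by_contra h
  rw [Complex.mem_slitPlane_iff_not_le_zero, not_not, Complex.nonpos_iff] at h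
  obtain ⟨hre, him⟩ := h
  set r := ((z - b) / (z - a)).re with hr
  have hza : z - a ≠ 0 := sub_ne_zero.2 (hz a ⟨le_rfl, hab.le⟩).symm
  have hq : (z - b) / (z - a) = r := Complex.ext rfl (by simpa using him)
  have h1r : 0 < 1 - r := by linarith
  have h1rC : (1 : ℂ) - r ≠ 0 := by exact_mod_cast h1r.ne'
  rw [div_eq_iff hza] at hq
  refine hz ((b - r * a) / (1 - r)) ⟨?_, ?_⟩ ?_
  · rw [le_div_iff₀ h1r]
    linarith
  · rw [div_le_iff₀ h1r]
    nlinarith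
  · push_cast
    rw [div_eq_iff h1rC]
    linear_combination -hq

/-- The branch of the square root of `∏ j, (z - a j)` that is holomorphic off the intervals and
asymptotic to `z ^ ℓ` at infinity. -/
noncomputable def sqrtPellH {ℓ : ℕ} (a : Fin (2 * ℓ) → ℝ) (z : ℂ) : ℂ :=
  ∏ j : Fin ℓ, (z - a ⟨2 * j, by omega⟩) *
    ((z - a ⟨2 * j + 1, by omega⟩) / (z - a ⟨2 * j, by omega⟩)) ^ (1 / 2 : ℂ)

section
variable {ℓ : ℕ} {a : Fin (2 * ℓ) → ℝ}

theorem StrictMono.pair_lt (ha : StrictMono a) (j : Fin ℓ) :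
    a ⟨2 * j, by omega⟩ < a ⟨2 * j + 1, by omega⟩ :=
  ha (by simp)

theorem ne_of_notMem_intervalUnion {z : ℂ} (hz : z ∉ intervalUnion a) (j : Fin ℓ) :
    ∀ x ∈ Set.Icc (a ⟨2 * j, by omega⟩) (a ⟨2 * j + 1, by omega⟩), (x : ℂ) ≠ z :=
  fun x hx hxz => hz (mem_intervalUnion.2 ⟨j, x, hx, hxz⟩)

theorem differentiableOn_sqrtPellH (ha : StrictMono a) :
    DifferentiableOn ℂ (sqrtPellH a) (intervalUnion a)ᶜ := by
  unfold sqrtPellH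
  refine DifferentiableOn.fun_finsetProd fun j _ z hz => DifferentiableAt.differentiableWithinAt ?_
  have hne := ne_of_notMem_intervalUnion hz j
  have hza := sub_ne_zero.2 (hne _ ⟨le_rfl, (ha.pair_lt j).le⟩).symm
  refine DifferentiableAt.mul (by fun_prop) (DifferentiableAt.cpow_const ?_ ?_)
  · exact DifferentiableAt.div (by fun_prop) (by fun_prop) hza
  · exact sub_div_sub_mem_slitPlane (ha.pair_lt j) hne

theorem sqrtPellH_sq (ha : StrictMono a) {z : ℂ} (hz : z ∉ intervalUnion a) :
    sqrtPellH a z ^ 2 = (pellH fun j => (a j : ℂ)).eval z := by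
  rw [pellH, eval_prod, prod_fin_two_mul, sqrtPellH, ← Finset.prod_pow]
  refine Finset.prod_congr rfl fun j _ => ?_
  have hza := sub_ne_zero.2
    (ne_of_notMem_intervalUnion hz j _ ⟨le_rfl, (ha.pair_lt j).le⟩).symm
  rw [mul_pow, ← Complex.cpow_nat_mul]
  simp only [Nat.cast_ofNat, one_div, ne_eq, OfNat.ofNat_ne_zero, not_false_eq_true,
    mul_inv_cancel₀, Complex.cpow_one, eval_sub, eval_X, eval_C]
  field_simp

theorem tendsto_sqrtPellH (a : Fin (2 * ℓ) → ℝ) :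
    Tendsto (fun z => sqrtPellH a z / z ^ ℓ) (cobounded ℂ) (𝓝 1) := by
  have h : Tendsto (fun z : ℂ => ∏ j : Fin ℓ, ((z - a ⟨2 * j, by omega⟩) / z) *
      ((z - a ⟨2 * j + 1, by omega⟩) / (z - a ⟨2 * j, by omega⟩)) ^ (1 / 2 : ℂ))
      (cobounded ℂ) (𝓝 (∏ _j : Fin ℓ, 1 * (1 : ℂ) ^ (1 / 2 : ℂ))) := by
    refine tendsto_finsetProd _ fun j _ => (tendsto_sub_div_self _).mul ?_
    exact (continuousAt_cpow_const Complex.one_mem_slitPlane).tendsto.comp (tendsto_sub_div_sub _ _)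
  simp only [Complex.one_cpow, mul_one, Finset.prod_const_one] at h
  refine h.congr fun z => ?_
  rw [sqrtPellH, ← Fin.prod_const, ← Finset.prod_div_distrib]
  exact Finset.prod_congr rfl fun j _ => by ring

/-! ### From the Pell equation to the inverse image -/

/-- `∏ j, (x - a j)` is nonpositive on the intervals. -/
theorem prod_sub_nonpos (ha : StrictMono a) (k : Fin ℓ) {x : ℝ}
    (hx : x ∈ Set.Icc (a ⟨2 * k, by omega⟩) (a ⟨2 * k + 1, by omega⟩)) :
    ∏ j, (x - a j) ≤ 0 := by
  -- Every pair other than the `k`-th lies on one side of `x`, so its two factors have the same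
  -- sign.
  rw [prod_fin_two_mul, ← Finset.mul_prod_erase _ _ (Finset.mem_univ k)]
  refine mul_nonpos_of_nonpos_of_nonneg
    (mul_nonpos_of_nonneg_of_nonpos (by linarith [hx.1]) (by linarith [hx.2])) ?_
  refine Finset.prod_nonneg fun j hj => ?_
  rcases lt_or_gt_of_ne (Finset.ne_of_mem_erase hj) with h | h
  · have h1 := ha.pair_lt j
    have h2 : a ⟨2 * j + 1, by omega⟩ < a ⟨2 * k, by omega⟩ := by
      apply ha; rw [Fin.mk_lt_mk]; omega
    exact mul_nonneg (by linarith [hx.1]) (by linarith [hx.1])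
  · have h1 := ha.pair_lt j
    have h2 : a ⟨2 * k + 1, by omega⟩ < a ⟨2 * j, by omega⟩ := by
      apply ha; rw [Fin.mk_lt_mk]; omega
    exact mul_nonneg_of_nonpos_of_nonpos (by linarith [hx.2]) (by linarith [hx.2])

theorem eval_pellH_ofReal (a : Fin (2 * ℓ) → ℝ) (x : ℝ) :
    (pellH fun j => (a j : ℂ)).eval (x : ℂ) = ((∏ j, (x - a j) : ℝ) : ℂ) := by
  simp [pellH, eval_prod]

theorem map_conj_pellH (a : Fin (2 * ℓ) → ℝ) :
    (pellH fun j => (a j : ℂ)).map (starRingEnd ℂ) = pellH fun j => (a j : ℂ) := by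
  simp [pellH, Polynomial.map_prod]

theorem eval_ofReal_im_eq_zero {P : ℂ[X]} (hP : P.map (starRingEnd ℂ) = P) (x : ℝ) :
    (P.eval (x : ℂ)).im = 0 := by
  rw [← Complex.conj_eq_iff_im, ← eval₂_hom, Complex.conj_ofReal, ← eval_map, hP]

/-- A polynomial solving the Pell equation with real `a j` has real coefficients. -/
theorem map_conj_eq_of_pell {P U : ℂ[X]} (hℓ : 1 ≤ ℓ) (hP : 0 < P.natDegree)
    (hpell : P ^ 2 - 1 = (pellH fun j => (a j : ℂ)) * U ^ 2) : P.map (starRingEnd ℂ) = P := by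
  have hconj : P.map (starRingEnd ℂ) ^ 2 - 1 =
      (pellH fun j => (a j : ℂ)) * U.map (starRingEnd ℂ) ^ 2 := by
    have := congrArg (Polynomial.map (starRingEnd ℂ)) hpell
    simpa [map_conj_pellH] using this
  have hnd := natDegree_map (p := P) (starRingEnd ℂ)
  rcases pell_unique (by rw [pellH_natDegree]; omega) hnd (hnd ▸ hP) hconj hpell with h | h
  · exact h
  exfalso
  -- At a zero of `H` the value of `P` is `±1`, real and nonzero, which rules out the minus sign.
  set x := a ⟨0, by omega⟩ with hx
  have h0 : P.eval (x : ℂ) ^ 2 = 1 := by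
    have := congrArg (eval (x : ℂ)) hpell
    rw [eval_mul, eval_pellH_ofReal, Finset.prod_eq_zero (Finset.mem_univ ⟨0, by omega⟩)
      (sub_self _)] at this
    simp only [eval_sub, eval_pow, eval_one, Complex.ofReal_zero, zero_mul] at this
    linear_combination this
  have h1 := congrArg (eval (x : ℂ)) h
  rw [eval_map, ← Complex.conj_ofReal x, eval₂_hom, Complex.conj_ofReal, eval_neg] at h1
  rcases sq_eq_one_iff.1 h0 with h2 | h2 <;> rw [h2] at h1 <;> norm_num at h1

theorem intervalUnion_subset_polyInvImage (ha : StrictMono a) {P U : ℂ[X]} (hℓ : 1 ≤ ℓ)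
    (hP : 0 < P.natDegree) (hlc : U.leadingCoeff = P.leadingCoeff)
    (hpell : P ^ 2 - 1 = (pellH fun j => (a j : ℂ)) * U ^ 2) :
    intervalUnion a ⊆ polyInvImage P := by
  have hPr := map_conj_eq_of_pell hℓ hP hpell
  have hP0 : P.leadingCoeff ≠ 0 := leadingCoeff_ne_zero.2 (ne_zero_of_natDegree_gt hP)
  have hUr : U.map (starRingEnd ℂ) = U := by
    have h := congrArg (Polynomial.map (starRingEnd ℂ)) hpell
    simp only [Polynomial.map_sub, Polynomial.map_pow, Polynomial.map_mul, map_conj_pellH, hPr,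
      Polynomial.map_one] at h
    rcases sq_eq_sq_iff_eq_or_eq_neg.1 (mul_left_cancel₀ (pellH_ne_zero _) (h.symm.trans hpell))
      with h | h
    · exact h
    · exfalso
      have h1 := congrArg leadingCoeff h
      have h2 := congrArg leadingCoeff hPr
      rw [leadingCoeff_map] at h2
      rw [leadingCoeff_neg, leadingCoeff_map, hlc, h2] at h1
      exact hP0 (self_eq_neg.1 h1)
  intro z hz
  obtain ⟨k, x, hx, rfl⟩ := mem_intervalUnion.1 hz
  have hPx : P.eval (x : ℂ) = ((P.eval (x : ℂ)).re : ℂ) :=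
    Complex.ext rfl (eval_ofReal_im_eq_zero hPr x)
  have hUx : U.eval (x : ℂ) = ((U.eval (x : ℂ)).re : ℂ) :=
    Complex.ext rfl (eval_ofReal_im_eq_zero hUr x)
  refine ⟨(P.eval (x : ℂ)).re, ?_, hPx⟩
  have h := congrArg (eval (x : ℂ)) hpell
  rw [eval_mul, eval_pow, eval_sub, eval_pow, eval_one, eval_pellH_ofReal, hPx, hUx] at h
  norm_cast at h
  have := mul_nonpos_of_nonpos_of_nonneg (prod_sub_nonpos ha k hx)
    (sq_nonneg (U.eval (x : ℂ)).re)
  exact Set.mem_Icc.2 (abs_le.1 (abs_le_one_iff_mul_self_le_one.2 (by nlinarith)))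

theorem polyInvImage_eq_of_satisfiesPell (ha : StrictMono a) {P : ℂ[X]} (hℓ : 1 ≤ ℓ)
    (h : SatisfiesPell P fun j => (a j : ℂ)) : polyInvImage P = intervalUnion a := by
  obtain ⟨U, hdeg, hlc, hpell⟩ := h
  have hP : 0 < P.natDegree := by omega
  have hP0 : P.leadingCoeff ≠ 0 := leadingCoeff_ne_zero.2 (ne_zero_of_natDegree_gt hP)
  have hsub := intervalUnion_subset_polyInvImage ha hℓ hP hlc hpell
  have hsq : ∀ z ∉ intervalUnion a, (U.eval z * sqrtPellH a z) ^ 2 = P.eval z ^ 2 - 1 := by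
    intro z hz
    have := congrArg (eval z) hpell
    rw [eval_mul, ← sqrtPellH_sq ha hz] at this
    simp only [eval_sub, eval_pow, eval_one] at this
    linear_combination -this
  refine (polyInvImage_subset_of_sqrt hP (isClosed_intervalUnion a) hsub
    (q := fun z => U.eval z * sqrtPellH a z)
    (U.differentiable.differentiableOn.mul (differentiableOn_sqrtPellH ha)) hsq ?_).antisymm hsub
  -- Equal leading coefficients matter here: the top terms of `P` and `U * √H` add instead of
  -- cancelling, so `P + U * √H` tends to infinity and its inverse `P - U * √H` is eventually small.
  have hlim : Tendsto (fun z => (P.eval z + U.eval z * sqrtPellH a z) / z ^ P.natDegree)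
      (cobounded ℂ) (𝓝 (P.leadingCoeff + U.leadingCoeff * 1)) := by
    refine ((tendsto_eval_div_pow P).add
      ((tendsto_eval_div_pow U).mul (tendsto_sqrtPellH a))).congr fun z => ?_
    rw [div_mul_div_comm, ← pow_add, hdeg, add_div]
  have hlc0 : P.leadingCoeff + U.leadingCoeff * 1 ≠ 0 := by
    rw [hlc, mul_one, ← two_mul]
    exact mul_ne_zero two_ne_zero hP0
  have htop : Tendsto (fun z => ‖P.eval z + U.eval z * sqrtPellH a z‖) (cobounded ℂ) atTop := by
    have hpow : Tendsto (fun z : ℂ => ‖z‖ ^ P.natDegree) (cobounded ℂ) atTop :=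
      (tendsto_pow_atTop hP.ne').comp tendsto_norm_cobounded_atTop
    refine (hpow.atTop_mul_pos (norm_pos_iff.2 hlc0) hlim.norm).congr' ?_
    filter_upwards [eventually_ne_cobounded (0 : ℂ)] with z hz
    rw [norm_div, norm_pow, mul_div_cancel₀]
    exact pow_ne_zero _ (norm_ne_zero_iff.2 hz)
  filter_upwards [htop.eventually_ge_atTop 1, isBounded_def.1 (isCompact_iUnion fun j : Fin ℓ =>
      (isCompact_Icc (a := a ⟨2 * j, by omega⟩) (b := a ⟨2 * j + 1, by omega⟩)).image
        Complex.continuous_ofReal).isBounded]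
    with z hz hzE
  have h1 : ‖P.eval z - U.eval z * sqrtPellH a z‖ * ‖P.eval z + U.eval z * sqrtPellH a z‖ = 1 := by
    rw [← norm_mul, show (P.eval z - U.eval z * sqrtPellH a z) *
      (P.eval z + U.eval z * sqrtPellH a z) = 1 by linear_combination -hsq z hzE, norm_one]
  nlinarith [norm_nonneg (P.eval z - U.eval z * sqrtPellH a z)]

end

/-! ### From the inverse image to the Pell equation -/

/-- The leading Taylor coefficient at `x` inherits one-sided sign conditions. -/
theorem pow_mul_eval_mem_of_eventually {f q : ℂ[X]} {x : ℝ} {m : ℕ}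
    (hf : f = (X - C (x : ℂ)) ^ m * q) {S : Set ℂ} (hS : IsClosed S)
    (hcone : ∀ c : ℝ, 0 < c → ∀ z ∈ S, (c : ℂ) * z ∈ S) {σ : ℝ}
    (h : ∀ᶠ t : ℝ in 𝓝[>] 0, f.eval ((x + σ * t : ℝ) : ℂ) ∈ S) :
    (σ : ℂ) ^ m * q.eval (x : ℂ) ∈ S := by
  have hcont : Continuous fun t : ℝ => (σ : ℂ) ^ m * q.eval ((x + σ * t : ℝ) : ℂ) := by fun_prop
  have hlim := (hcont.tendsto 0).mono_left (nhdsWithin_le_nhds (s := Set.Ioi 0))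
  simp only [mul_zero, add_zero] at hlim
  refine hS.mem_of_tendsto hlim ?_
  filter_upwards [h, self_mem_nhdsWithin] with t ht htpos
  have htpos : 0 < t := htpos
  have ht0 : (t : ℂ) ≠ 0 := by exact_mod_cast htpos.ne'
  have := hcone ((t ^ m)⁻¹) (by positivity) _ ht
  convert this using 1
  rw [hf]
  simp only [eval_mul, eval_pow, eval_sub, eval_X, eval_C]
  push_cast
  rw [show (x + σ * t - x : ℂ) = σ * t by ring, mul_pow]
  field_simp

theorem isClosed_im_eq_zero_and_re_nonpos : IsClosed {z : ℂ | z.im = 0 ∧ z.re ≤ 0} :=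
  (isClosed_eq Complex.continuous_im continuous_const).inter
    (isClosed_le Complex.continuous_re continuous_const)

theorem isClosed_im_eq_zero_and_re_nonneg : IsClosed {z : ℂ | z.im = 0 ∧ 0 ≤ z.re} :=
  (isClosed_eq Complex.continuous_im continuous_const).inter
    (isClosed_le continuous_const Complex.continuous_re)

/-- A polynomial which is nonpositive on both sides of `x` vanishes at `x` to even order. -/
theorem even_rootMultiplicity {f : ℂ[X]} (hf : f ≠ 0) {x : ℝ}
    (h : ∀ᶠ t : ℝ in 𝓝[>] 0, ∀ σ : ℝ, σ = 1 ∨ σ = -1 →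
      f.eval ((x + σ * t : ℝ) : ℂ) ∈ {z : ℂ | z.im = 0 ∧ z.re ≤ 0}) :
    Even (f.rootMultiplicity (x : ℂ)) := by
  obtain ⟨q, hq, hdvd⟩ := exists_eq_pow_rootMultiplicity_mul_and_not_dvd f hf (x : ℂ)
  rw [dvd_iff_isRoot] at hdvd
  have key : ∀ σ : ℝ, σ = 1 ∨ σ = -1 → _ := fun σ hσ =>
    pow_mul_eval_mem_of_eventually hq isClosed_im_eq_zero_and_re_nonpos
      (fun c hc z hz => by simp [hz.1, mul_nonpos_of_nonneg_of_nonpos hc.le hz.2]) (σ := σ)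
      (h.mono fun t ht => ht σ hσ)
  -- For odd order, the leading coefficient and its negative would both be nonpositive reals, so it
  -- would vanish.
  rcases Nat.even_or_odd (f.rootMultiplicity (x : ℂ)) with he | ho
  · exact he
  exfalso
  have h1 := key 1 (Or.inl rfl)
  have h2 := key (-1) (Or.inr rfl)
  simp only [Complex.ofReal_one, Complex.ofReal_neg, one_pow, one_mul, ho.neg_one_pow, neg_mul,
    Set.mem_ofPred_eq, Complex.neg_re, Complex.neg_im] at h1 h2
  exact hdvd (Complex.ext (by simpa using le_antisymm h1.2 (by linarith)) (by simpa using h1.1))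

/-- A polynomial which is nonpositive on one side of `x` and nonnegative on the other side vanishes
at `x` to odd order. -/
theorem odd_rootMultiplicity {f : ℂ[X]} (hf : f ≠ 0) {x σ : ℝ} (hσ : σ = 1 ∨ σ = -1)
    (hneg : ∀ᶠ t : ℝ in 𝓝[>] 0, f.eval ((x + σ * t : ℝ) : ℂ) ∈ {z : ℂ | z.im = 0 ∧ z.re ≤ 0})
    (hpos : ∀ᶠ t : ℝ in 𝓝[>] 0, f.eval ((x + -σ * t : ℝ) : ℂ) ∈ {z : ℂ | z.im = 0 ∧ 0 ≤ z.re}) :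
    Odd (f.rootMultiplicity (x : ℂ)) := by
  obtain ⟨q, hq, hdvd⟩ := exists_eq_pow_rootMultiplicity_mul_and_not_dvd f hf (x : ℂ)
  rw [dvd_iff_isRoot] at hdvd
  have h1 := pow_mul_eval_mem_of_eventually hq isClosed_im_eq_zero_and_re_nonpos
    (fun c hc z hz => by simp [hz.1, mul_nonpos_of_nonneg_of_nonpos hc.le hz.2]) hneg
  have h2 := pow_mul_eval_mem_of_eventually hq isClosed_im_eq_zero_and_re_nonneg
    (fun c hc z hz => by simp [hz.1, mul_nonneg hc.le hz.2]) hpos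
  rcases Nat.even_or_odd (f.rootMultiplicity (x : ℂ)) with he | ho
  · exfalso
    have hs : ((σ : ℝ) : ℂ) ^ f.rootMultiplicity (x : ℂ) = 1 := by
      rcases hσ with rfl | rfl <;> simp [he.neg_one_pow]
    rw [Complex.ofReal_neg, he.neg_pow, hs, one_mul] at h2
    rw [hs, one_mul] at h1
    exact hdvd (Complex.ext (by simpa using le_antisymm h1.2 h2.2) (by simpa using h1.1))
  · exact ho

theorem mem_polyInvImage_of_isRoot {P : ℂ[X]} {r : ℂ} (hr : (P ^ 2 - 1).IsRoot r) :
    r ∈ polyInvImage P := by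
  have : P.eval r ^ 2 = 1 := by simpa [IsRoot, sub_eq_zero] using hr
  rcases sq_eq_one_iff.1 this with h1 | h1
  · exact ⟨1, by norm_num, by simp [h1]⟩
  · exact ⟨-1, by norm_num, by simp [h1]⟩

section
variable {ℓ : ℕ} {a : Fin (2 * ℓ) → ℝ} {P : ℂ[X]}

/-- `P` takes real values on a whole interval, so it agrees with its conjugate at infinitely many
points. -/
theorem map_conj_eq_of_intervalUnion_subset (hℓ : 1 ≤ ℓ) (ha : StrictMono a)
    (h : intervalUnion a ⊆ polyInvImage P) : P.map (starRingEnd ℂ) = P := by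
  refine eq_of_infinite_eval_eq _ _ (Set.Infinite.mono (s := Complex.ofReal ''
    Set.Icc (a ⟨2 * (⟨0, hℓ⟩ : Fin ℓ), by omega⟩) (a ⟨2 * (⟨0, hℓ⟩ : Fin ℓ) + 1, by omega⟩)) ?_
    ((Set.Icc_infinite (ha.pair_lt ⟨0, hℓ⟩)).image Complex.ofReal_injective.injOn))
  rintro _ ⟨x, hx, rfl⟩
  obtain ⟨t, -, ht⟩ := h (ofReal_mem_intervalUnion.2 ⟨_, hx⟩)
  rw [Set.mem_ofPred_eq, eval_map, ← Complex.conj_ofReal x, eval₂_hom, Complex.conj_ofReal, ht,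
    Complex.conj_ofReal]

theorem eval_sq_sub_one_of_mem {z : ℂ} (hz : z ∈ polyInvImage P) :
    (P ^ 2 - 1).eval z ∈ {z : ℂ | z.im = 0 ∧ z.re ≤ 0} := by
  obtain ⟨t, ⟨h1, h2⟩, ht⟩ := hz
  have : (P ^ 2 - 1).eval z = ((t ^ 2 - 1 : ℝ) : ℂ) := by simp [ht]
  rw [this]
  exact ⟨Complex.ofReal_im _, by rw [Complex.ofReal_re]; nlinarith⟩

theorem eval_sq_sub_one_of_notMem (hP : P.map (starRingEnd ℂ) = P) {x : ℝ}
    (hx : (x : ℂ) ∉ polyInvImage P) :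
    (P ^ 2 - 1).eval (x : ℂ) ∈ {z : ℂ | z.im = 0 ∧ 0 ≤ z.re} := by
  have hPx : P.eval (x : ℂ) = ((P.eval (x : ℂ)).re : ℂ) :=
    Complex.ext rfl (eval_ofReal_im_eq_zero hP x)
  set u := (P.eval (x : ℂ)).re
  have : (P ^ 2 - 1).eval (x : ℂ) = ((u ^ 2 - 1 : ℝ) : ℂ) := by simp [hPx]
  rw [this]
  refine ⟨Complex.ofReal_im _, ?_⟩
  rw [Complex.ofReal_re]
  by_contra! hlt
  exact hx ⟨u, abs_le.1 (abs_le_one_iff_mul_self_le_one.2 (by nlinarith)), hPx⟩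

theorem eventually_nhdsGT_zero_lt {c : ℝ} (hc : 0 < c) : ∀ᶠ t : ℝ in 𝓝[>] 0, 0 < t ∧ t < c :=
  Ioo_mem_nhdsGT hc

theorem eventually_notMem_of_left_endpoint (ha : StrictMono a) (j : Fin ℓ) :
    ∀ᶠ t : ℝ in 𝓝[>] 0,
      ((a ⟨2 * j, by omega⟩ + -1 * t : ℝ) : ℂ) ∉ intervalUnion a := by
  simp only [ofReal_mem_intervalUnion, not_exists]
  rw [eventually_all]
  intro k
  rcases lt_or_ge k j with h | h
  · have h2 : a ⟨2 * k + 1, by omega⟩ < a ⟨2 * j, by omega⟩ := by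
      apply ha; rw [Fin.mk_lt_mk]; omega
    filter_upwards [eventually_nhdsGT_zero_lt (sub_pos.2 h2)] with t ht hmem
    linarith [hmem.2]
  · have h2 : a ⟨2 * j, by omega⟩ ≤ a ⟨2 * k, by omega⟩ := by
      apply ha.monotone; rw [Fin.mk_le_mk]; omega
    filter_upwards [self_mem_nhdsWithin] with t ht hmem
    have ht : 0 < t := ht
    linarith [hmem.1]

theorem eventually_notMem_of_right_endpoint (ha : StrictMono a) (j : Fin ℓ) :
    ∀ᶠ t : ℝ in 𝓝[>] 0,
      ((a ⟨2 * j + 1, by omega⟩ + 1 * t : ℝ) : ℂ) ∉ intervalUnion a := by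
  simp only [ofReal_mem_intervalUnion, not_exists]
  rw [eventually_all]
  intro k
  rcases lt_or_ge j k with h | h
  · have h2 : a ⟨2 * j + 1, by omega⟩ < a ⟨2 * k, by omega⟩ := by
      apply ha; rw [Fin.mk_lt_mk]; omega
    filter_upwards [eventually_nhdsGT_zero_lt (sub_pos.2 h2)] with t ht hmem
    linarith [hmem.1]
  · have h2 : a ⟨2 * k + 1, by omega⟩ ≤ a ⟨2 * j + 1, by omega⟩ := by
      apply ha.monotone; rw [Fin.mk_le_mk]; omega
    filter_upwards [self_mem_nhdsWithin] with t ht hmem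
    have ht : 0 < t := ht
    linarith [hmem.2]

/-- All zeros of `P ^ 2 - 1` lie in the intervals. On the real line this polynomial is nonpositive
on the intervals and nonnegative off them, so its order is odd at endpoints and even at interior
points. -/
theorem satisfiesPell_of_polyInvImage_eq (hP : 0 < P.natDegree) (hℓ : 1 ≤ ℓ) (ha : StrictMono a)
    (h : polyInvImage P = intervalUnion a) : SatisfiesPell P fun j => (a j : ℂ) := by
  have hPr := map_conj_eq_of_intervalUnion_subset hℓ ha h.ge
  have hf : P ^ 2 - 1 ≠ 0 :=
    ne_zero_of_natDegree_gt (n := 0) (by rw [natDegree_sq_sub_one]; omega)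
  refine satisfiesPell_of_odd_rootMultiplicity hP
    (fun i j hij => ha.injective (Complex.ofReal_injective hij)) fun r => ⟨fun hodd => ?_, ?_⟩
  · by_contra hr
    refine Nat.not_even_iff_odd.2 hodd ?_
    have hroot := (rootMultiplicity_pos hf).1 hodd.pos
    have hmem := mem_polyInvImage_of_isRoot hroot
    rw [h] at hmem
    obtain ⟨j, x, hx, rfl⟩ := mem_intervalUnion.1 hmem
    have h1 : a ⟨2 * j, by omega⟩ < x :=
      lt_of_le_of_ne hx.1 fun h => hr ⟨_, congrArg Complex.ofReal h⟩
    have h2 : x < a ⟨2 * j + 1, by omega⟩ :=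
      lt_of_le_of_ne hx.2 fun h => hr ⟨_, congrArg Complex.ofReal h.symm⟩
    refine even_rootMultiplicity hf ?_
    filter_upwards [eventually_nhdsGT_zero_lt (sub_pos.2 h1),
      eventually_nhdsGT_zero_lt (sub_pos.2 h2)] with t ht1 ht2 σ hσ
    refine eval_sq_sub_one_of_mem (h.ge (ofReal_mem_intervalUnion.2 ⟨j, ?_⟩))
    rcases hσ with rfl | rfl <;> constructor <;> linarith
  · rintro ⟨i, rfl⟩
    obtain ⟨j, hj⟩ : ∃ j : Fin ℓ, i = ⟨2 * j, by omega⟩ ∨ i = ⟨2 * j + 1, by omega⟩ :=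
      ⟨⟨i / 2, by omega⟩, by simp only [Fin.ext_iff]; omega⟩
    have hlt := ha.pair_lt j
    rcases hj with rfl | rfl
    · refine odd_rootMultiplicity hf (Or.inl rfl) ?_ ?_
      · filter_upwards [eventually_nhdsGT_zero_lt (sub_pos.2 hlt)] with t ht
        refine eval_sq_sub_one_of_mem (h.ge (ofReal_mem_intervalUnion.2 ⟨j, ?_⟩))
        constructor <;> linarith
      · filter_upwards [eventually_notMem_of_left_endpoint ha j] with t ht
        exact eval_sq_sub_one_of_notMem hPr (h ▸ ht)
    · refine odd_rootMultiplicity hf (Or.inr rfl) ?_ ?_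
      · filter_upwards [eventually_nhdsGT_zero_lt (sub_pos.2 hlt)] with t ht
        refine eval_sq_sub_one_of_mem (h.ge (ofReal_mem_intervalUnion.2 ⟨j, ?_⟩))
        constructor <;> linarith
      · rw [neg_neg]
        filter_upwards [eventually_notMem_of_right_endpoint ha j] with t ht
        exact eval_sq_sub_one_of_notMem hPr (h ▸ ht)

end

/-! ### Jordan arcs and simple zeros of `P ^ 2 - 1` -/

theorem derivative_sq_sub_one (P : ℂ[X]) :
    derivative (P ^ 2 - 1) = C 2 * P * derivative P := by
  simp [derivative_pow]

/-- At an interior point of an arc mapped into `[-1, 1]`, a value `±1` is not taken simply. -/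
theorem rootMultiplicity_ne_one_of_path {P : ℂ[X]} {a₁ a₂ : ℂ} {γ : Path a₁ a₂}
    (hγ : Function.Injective γ) (hsub : Set.range γ ⊆ polyInvImage P) {t₀ : unitInterval}
    (h0 : 0 < t₀) (h1 : t₀ < 1) : (P ^ 2 - 1).rootMultiplicity (γ t₀) ≠ 1 := by
  intro hmul
  have hf : P ^ 2 - 1 ≠ 0 := by
    intro h
    simp [h] at hmul
  have hroot : (P ^ 2 - 1).IsRoot (γ t₀) := (rootMultiplicity_pos hf).1 (by omega)
  have hder : (derivative P).eval (γ t₀) ≠ 0 := by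
    intro h
    have := (one_lt_rootMultiplicity_iff_isRoot hf (t := γ t₀)).2
      ⟨hroot, by rw [IsRoot, derivative_sq_sub_one, eval_mul, h, mul_zero]⟩
    omega
  -- A simple zero is not critical for `P`, so `P` is injective nearby and `Re (P ∘ γ)` is injective
  -- near `t₀`. It is then strictly monotone there, yet attains its bound `±1` at the interior point
  -- `t₀`.
  have hinv := HasStrictFDerivAt.eventually_left_inverse
    ((P.hasStrictDerivAt (γ t₀)).hasStrictFDerivAt_equiv hder)
  have hcont : Tendsto γ.extend (𝓝 (t₀ : ℝ)) (𝓝 (γ t₀)) := by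
    have := γ.continuous_extend.tendsto (t₀ : ℝ)
    rwa [γ.extend_apply t₀.2] at this
  obtain ⟨ε, hε, hball⟩ := Metric.eventually_nhds_iff_ball.1
    ((hcont.eventually hinv).and
      (Ioo_mem_nhds (show (0 : ℝ) < t₀ from h0) (show (t₀ : ℝ) < 1 from h1)))
  have hIcc : ∀ s ∈ Set.Icc ((t₀ : ℝ) - ε / 2) (t₀ + ε / 2), s ∈ Metric.ball (t₀ : ℝ) ε := by
    intro s hs
    rw [Real.ball_eq_Ioo]
    constructor <;> linarith [hs.1, hs.2]
  have hval : ∀ s ∈ Set.Icc ((t₀ : ℝ) - ε / 2) (t₀ + ε / 2), ∃ u ∈ Set.Icc (-1 : ℝ) 1,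
      P.eval (γ.extend s) = u := by
    intro s hs
    obtain ⟨-, hs01⟩ := hball s (hIcc s hs)
    rw [γ.extend_apply ⟨hs01.1.le, hs01.2.le⟩]
    exact hsub ⟨_, rfl⟩
  have hφ : ContinuousOn (fun s => (P.eval (γ.extend s)).re)
      (Set.Icc ((t₀ : ℝ) - ε / 2) (t₀ + ε / 2)) :=
    (Complex.continuous_re.comp (P.continuous.comp γ.continuous_extend)).continuousOn
  have hinj : Set.InjOn (fun s => (P.eval (γ.extend s)).re)
      (Set.Icc ((t₀ : ℝ) - ε / 2) (t₀ + ε / 2)) := by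
    intro s hs t ht hst
    obtain ⟨u, -, hu⟩ := hval s hs
    obtain ⟨v, -, hv⟩ := hval t ht
    obtain ⟨hs1, hs01⟩ := hball s (hIcc s hs)
    obtain ⟨ht1, ht01⟩ := hball t (hIcc t ht)
    simp only [hu, hv, Complex.ofReal_re] at hst
    rw [hu, hst, ← hv, ht1] at hs1
    rw [γ.extend_apply ⟨hs01.1.le, hs01.2.le⟩, γ.extend_apply ⟨ht01.1.le, ht01.2.le⟩] at hs1
    exact (congrArg Subtype.val (hγ hs1)).symm
  have hle : ∀ s ∈ Set.Icc ((t₀ : ℝ) - ε / 2) (t₀ + ε / 2),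
      -1 ≤ (P.eval (γ.extend s)).re ∧ (P.eval (γ.extend s)).re ≤ 1 := by
    intro s hs
    obtain ⟨u, hu1, hu⟩ := hval s hs
    rwa [hu, Complex.ofReal_re]
  have hml : (t₀ : ℝ) - ε / 2 ∈ Set.Icc ((t₀ : ℝ) - ε / 2) (t₀ + ε / 2) := by
    constructor <;> linarith
  have hm : (t₀ : ℝ) ∈ Set.Icc ((t₀ : ℝ) - ε / 2) (t₀ + ε / 2) := by constructor <;> linarith
  have hmr : (t₀ : ℝ) + ε / 2 ∈ Set.Icc ((t₀ : ℝ) - ε / 2) (t₀ + ε / 2) := by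
    constructor <;> linarith
  have hend : (P.eval (γ.extend t₀)).re = 1 ∨ (P.eval (γ.extend t₀)).re = -1 := by
    rw [γ.extend_apply t₀.2]
    have : P.eval (γ t₀) ^ 2 = 1 := by simpa [IsRoot, sub_eq_zero] using hroot
    rcases sq_eq_one_iff.1 this with h | h
    · left
      change (P.eval (γ t₀)).re = 1
      simp [h]
    · right
      change (P.eval (γ t₀)).re = -1
      simp [h]
  have hll := hle _ hml
  have hrr := hle _ hmr
  rcases hφ.strictMonoOn_of_injOn_Icc' (by linarith) hinj with hmono | hmono
  · have h2 := hmono hml hm (by linarith)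
    have h3 := hmono hm hmr (by linarith)
    simp only at h2 h3
    rcases hend with h | h <;> linarith
  · have h2 := hmono hml hm (by linarith)
    have h3 := hmono hm hmr (by linarith)
    simp only at h2 h3
    rcases hend with h | h <;> linarith

/-- The zeros of `P ^ 2 - 1`, counted without one of each, are critical points of `P`. -/
theorem sum_rootMultiplicity_sub_one_lt {P : ℂ[X]} (hP : 0 < P.natDegree) :
    ∑ r ∈ (P ^ 2 - 1).roots.toFinset, ((P ^ 2 - 1).rootMultiplicity r - 1) < P.natDegree := by
  classical
  have hP0 : P ≠ 0 := ne_zero_of_natDegree_gt hP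
  have hf : P ^ 2 - 1 ≠ 0 :=
    ne_zero_of_natDegree_gt (n := 0) (by rw [natDegree_sq_sub_one]; omega)
  have hP' : derivative P ≠ 0 := fun h => hP.ne' (derivative_eq_zero.1 h)
  have hle : ∀ r ∈ (P ^ 2 - 1).roots.toFinset,
      (P ^ 2 - 1).rootMultiplicity r - 1 ≤ (derivative P).roots.count r := by
    intro r hr
    have hroot : (P ^ 2 - 1).IsRoot r := isRoot_of_mem_roots (Multiset.mem_toFinset.1 hr)
    refine (rootMultiplicity_sub_one_le_derivative_rootMultiplicity _ r).trans ?_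
    -- `P` is `±1` at `r`, so the order of `2 * P * P'` there is that of `P'`.
    rw [derivative_sq_sub_one, count_roots, mul_assoc, rootMultiplicity_mul, rootMultiplicity_C,
      rootMultiplicity_mul (mul_ne_zero hP0 hP'), rootMultiplicity_eq_zero (p := P), zero_add,
      zero_add]
    · intro h
      simp [IsRoot, h.eq_zero] at hroot
    · simp [hP0, hP']
  calc _ ≤ ∑ r ∈ (P ^ 2 - 1).roots.toFinset, (derivative P).roots.count r := Finset.sum_le_sum hle
    _ ≤ ∑ r ∈ (P ^ 2 - 1).roots.toFinset ∪ (derivative P).roots.toFinset,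
        (derivative P).roots.count r := Finset.sum_le_sum_of_subset Finset.subset_union_left
    _ = (derivative P).roots.card := Multiset.sum_count_eq_card fun r hr =>
        Finset.mem_union_right _ (Multiset.mem_toFinset.2 hr)
    _ ≤ (derivative P).natDegree := card_roots' _
    _ < P.natDegree := natDegree_derivative_lt hP.ne'

/-- If at most two zeros of `P ^ 2 - 1` are simple, then exactly two are, and all others are
double. -/
theorem odd_rootMultiplicity_iff_of_simple_subset {P : ℂ[X]} (hP : 0 < P.natDegree) {a₁ a₂ : ℂ}
    (hne : a₁ ≠ a₂)
    (h : ∀ r, (P ^ 2 - 1).rootMultiplicity r = 1 → r = a₁ ∨ r = a₂) (r : ℂ) :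
    Odd ((P ^ 2 - 1).rootMultiplicity r) ↔ r = a₁ ∨ r = a₂ := by
  classical
  have hlt := sum_rootMultiplicity_sub_one_lt hP
  have hf : P ^ 2 - 1 ≠ 0 :=
    ne_zero_of_natDegree_gt (n := 0) (by rw [natDegree_sq_sub_one]; omega)
  set m : ℂ → ℕ := fun r => (P ^ 2 - 1).rootMultiplicity r with hm
  set R := (P ^ 2 - 1).roots.toFinset with hR
  have hmem : ∀ r, r ∈ R ↔ 0 < m r := by
    intro r
    rw [hR, Multiset.mem_toFinset, mem_roots hf, hm, ← rootMultiplicity_pos hf]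
  have hsum : ∑ r ∈ R, m r = 2 * P.natDegree := by
    rw [← natDegree_sq_sub_one, ← splits_iff_card_roots.1 (IsAlgClosed.splits (P ^ 2 - 1)),
      ← Multiset.toFinset_sum_count_eq]
    simp [hm, hR]
  -- One unit is added at each `aᵢ`, the only possible simple zeros, so every zero has weight at
  -- least `2`. The total weight is at most `2 * deg P + 2`, and there are at least `deg P + 1`
  -- distinct zeros; hence equality holds throughout.
  set w : ℂ → ℕ := fun r => m r + (if r = a₁ then 1 else 0) + (if r = a₂ then 1 else 0) with hw
  have hw2 : ∀ r ∈ R, 2 ≤ w r := by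
    intro r hr
    have h1 := (hmem r).1 hr
    have h2 := h r
    change m r = 1 → _ at h2
    simp only [hw]
    split_ifs with h3 h4 h4
    · omega
    · omega
    · omega
    · have : m r ≠ 1 := fun e => (h2 e).elim h3 h4
      omega
  have hwsum : ∑ r ∈ R, w r = 2 * P.natDegree + (if a₁ ∈ R then 1 else 0) +
      (if a₂ ∈ R then 1 else 0) := by
    simp only [hw, Finset.sum_add_distrib, hsum, Finset.sum_ite_eq']
  have hcard : P.natDegree + 1 ≤ R.card := by
    have : ∑ r ∈ R, (m r - 1) + R.card = ∑ r ∈ R, m r := by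
      rw [Finset.card_eq_sum_ones, ← Finset.sum_add_distrib]
      exact Finset.sum_congr rfl fun r hr => Nat.sub_add_cancel ((hmem r).1 hr)
    change ∑ r ∈ R, (m r - 1) < _ at hlt
    omega
  have hle : R.card * 2 ≤ ∑ r ∈ R, w r := by
    simpa using Finset.card_nsmul_le_sum R w 2 hw2
  have ha₁ : a₁ ∈ R := by
    by_contra hc
    rw [hwsum, if_neg hc] at hle
    split_ifs at hle <;> omega
  have ha₂ : a₂ ∈ R := by
    by_contra hc
    rw [hwsum, if_neg hc] at hle
    split_ifs at hle
    omega
  rw [if_pos ha₁, if_pos ha₂] at hwsum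
  have heq : ∀ r ∈ R, w r = 2 := by
    have : ∑ r ∈ R, 2 = ∑ r ∈ R, w r := by
      rw [Finset.sum_const, smul_eq_mul]
      omega
    exact fun r hr => (((Finset.sum_eq_sum_iff_of_le hw2).1 this) r hr).symm
  change Odd (m r) ↔ _
  constructor
  · intro hodd
    have := heq r ((hmem r).2 hodd.pos)
    by_contra! hc
    simp only [hw, if_neg hc.1, if_neg hc.2] at this
    rw [add_zero, add_zero] at this
    rw [this] at hodd
    exact absurd hodd (by decide)
  · rintro (rfl | rfl)
    · have := heq r ha₁
      simp only [hw, if_true, if_neg hne] at this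
      rw [show m r = 1 by omega]
      exact odd_one
    · have := heq r ha₂
      simp only [hw, if_true, if_neg hne.symm] at this
      rw [show m r = 1 by omega]
      exact odd_one

theorem satisfiesPell_of_isJordanArc {P : ℂ[X]} (hP : 0 < P.natDegree) {a₁ a₂ : ℂ}
    (hne : a₁ ≠ a₂) (h : IsJordanArc (polyInvImage P) a₁ a₂) :
    SatisfiesPell (ℓ := 1) P ![a₁, a₂] := by
  obtain ⟨γ, hγ, hrange⟩ := h
  refine satisfiesPell_of_odd_rootMultiplicity hP ?_ fun r => ?_
  · intro i j hij
    fin_cases i <;> fin_cases j <;> simp_all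
  rw [odd_rootMultiplicity_iff_of_simple_subset hP hne]
  · constructor
    · rintro (rfl | rfl)
      · exact ⟨(0 : Fin 2), rfl⟩
      · exact ⟨(1 : Fin 2), rfl⟩
    · rintro ⟨i, rfl⟩
      fin_cases i <;> simp
  · intro r hr
    have hf : P ^ 2 - 1 ≠ 0 := by
      intro h
      simp [h] at hr
    have hmem := mem_polyInvImage_of_isRoot ((rootMultiplicity_pos hf).1 (hr ▸ one_pos))
    rw [← hrange] at hmem
    obtain ⟨t, rfl⟩ := hmem
    by_contra! hc
    refine rootMultiplicity_ne_one_of_path hγ hrange.le (t₀ := t) ?_ ?_ hr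
    · exact unitInterval.pos_iff_ne_zero.2 fun h => hc.1 (by rw [h, γ.source])
    · exact unitInterval.lt_one_iff_ne_one.2 fun h => hc.2 (by rw [h, γ.target])

/-! ### Chebyshev polynomials and segments -/

/-- The polynomial form of `cos² - 1 = -sin²`; it makes `T` a Pell solution for the interval `[-1,
1]`. -/
theorem chebyshev_T_sq_sub_one (n : ℕ) :
    (Chebyshev.T ℂ (n + 1 : ℕ)) ^ 2 - 1 = (X ^ 2 - 1) * (Chebyshev.U ℂ n) ^ 2 := by
  induction n with
  | zero => simp
  | succ n ih =>
    have h1 := Chebyshev.T_eq_X_mul_T_sub_pol_U ℂ n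
    have h2 := Chebyshev.U_eq_X_mul_U_add_T ℂ n
    push_cast at ih ⊢
    rw [show (n + 1 + 1 : ℤ) = n + 2 by ring, h1, h2]
    linear_combination ih

theorem satisfiesPell_chebyshev {n : ℕ} (hn : 1 ≤ n) :
    SatisfiesPell (ℓ := 1) (Chebyshev.T ℂ n) fun j => ((![(-1 : ℝ), 1] j : ℝ) : ℂ) := by
  obtain ⟨n, rfl⟩ : ∃ k, n = k + 1 := ⟨n - 1, by omega⟩
  refine ⟨Chebyshev.U ℂ n, ?_, ?_, ?_⟩
  · rw [Chebyshev.natDegree_U_natCast, Chebyshev.natDegree_T, Int.natAbs_natCast]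
  · rw [Chebyshev.leadingCoeff_U_natCast, Chebyshev.leadingCoeff_T, Int.natAbs_natCast,
      Nat.add_sub_cancel]
  · rw [chebyshev_T_sq_sub_one]
    congr 1
    change _ = ∏ j : Fin 2, _
    simp [Fin.prod_univ_two]
    ring

theorem polyInvImage_chebyshev {n : ℕ} (hn : 1 ≤ n) :
    polyInvImage (Chebyshev.T ℂ n) = Complex.ofReal '' Set.Icc (-1) 1 := by
  have ha : StrictMono (![-1, 1] : Fin (2 * 1) → ℝ) := by
    intro i j hij
    fin_cases i <;> fin_cases j <;> simp_all
  rw [polyInvImage_eq_of_satisfiesPell (ℓ := 1) ha le_rfl (satisfiesPell_chebyshev hn)]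
  ext z
  rw [mem_intervalUnion, Fin.exists_fin_one]
  rfl

theorem mem_segment_iff_affine {a₁ a₂ : ℂ} (hne : a₁ ≠ a₂) {z : ℂ} :
    z ∈ segment ℝ a₁ a₂ ↔
      (2 * z - a₁ - a₂) / (a₂ - a₁) ∈ Complex.ofReal '' Set.Icc (-1) 1 := by
  have h0 : a₂ - a₁ ≠ 0 := sub_ne_zero.2 hne.symm
  rw [segment_eq_image']
  constructor
  · rintro ⟨t, ⟨ht0, ht1⟩, rfl⟩
    refine ⟨2 * t - 1, ⟨by linarith, by linarith⟩, ?_⟩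
    rw [eq_div_iff h0]
    simp only [Complex.real_smul]
    push_cast
    ring
  · rintro ⟨t, ⟨ht0, ht1⟩, ht⟩
    refine ⟨(t + 1) / 2, ⟨by linarith, by linarith⟩, ?_⟩
    rw [eq_div_iff h0] at ht
    simp only [Complex.real_smul]
    push_cast
    linear_combination ht / 2

theorem polyInvImage_neg (P : ℂ[X]) : polyInvImage (-P) = polyInvImage P := by
  have key : ∀ Q : ℂ[X], polyInvImage Q ⊆ polyInvImage (-Q) := by
    rintro Q z ⟨t, ⟨h1, h2⟩, ht⟩
    exact ⟨-t, ⟨by linarith, by linarith⟩, by simp [ht]⟩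
  have h := key (-P)
  rw [neg_neg] at h
  exact Set.Subset.antisymm h (key P)

/-- The Chebyshev polynomial of the segment `[a₁, a₂]`. -/
noncomputable def segmentChebyshev (n : ℕ) (a₁ a₂ : ℂ) : ℂ[X] :=
  (Chebyshev.T ℂ n).comp (C (2 / (a₂ - a₁)) * X + C (-(a₁ + a₂) / (a₂ - a₁)))

section
variable {n : ℕ} {a₁ a₂ : ℂ}

theorem eval_segmentChebyshev (n : ℕ) (a₁ a₂ z : ℂ) : (segmentChebyshev n a₁ a₂).eval z =
    (Chebyshev.T ℂ n).eval ((2 * z - a₁ - a₂) / (a₂ - a₁)) := by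
  rw [segmentChebyshev, eval_comp]
  congr 1
  simp only [eval_add, eval_mul, eval_C, eval_X]
  ring

theorem natDegree_segmentChebyshev (hne : a₁ ≠ a₂) :
    (segmentChebyshev n a₁ a₂).natDegree = n := by
  rw [segmentChebyshev, natDegree_comp, Chebyshev.natDegree_T,
    natDegree_linear (div_ne_zero two_ne_zero (sub_ne_zero.2 hne.symm)), mul_one,
    Int.natAbs_natCast]

theorem polyInvImage_segmentChebyshev (hn : 1 ≤ n) (hne : a₁ ≠ a₂) :
    polyInvImage (segmentChebyshev n a₁ a₂) = segment ℝ a₁ a₂ := by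
  ext z
  rw [mem_segment_iff_affine hne, ← polyInvImage_chebyshev hn]
  simp only [polyInvImage, Set.mem_ofPred_eq, eval_segmentChebyshev]

theorem pell_segmentChebyshev (hn : 1 ≤ n) (hne : a₁ ≠ a₂) : ∃ U : ℂ[X],
    segmentChebyshev n a₁ a₂ ^ 2 - 1 = pellH (ℓ := 1) ![a₁, a₂] * U ^ 2 := by
  obtain ⟨n, rfl⟩ : ∃ k, n = k + 1 := ⟨n - 1, by omega⟩
  have h0 : a₂ - a₁ ≠ 0 := sub_ne_zero.2 hne.symm
  -- The factor `2 / (a₂ - a₁)` is the slope of the affine change of variable; its square turns `(X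
  -- - a₁)(X - a₂)` into the pullback of `X ^ 2 - 1`.
  refine ⟨C (2 / (a₂ - a₁)) *
    (Chebyshev.U ℂ n).comp (C (2 / (a₂ - a₁)) * X + C (-(a₁ + a₂) / (a₂ - a₁))), ?_⟩
  have h := congrArg (fun p : ℂ[X] => p.comp (C (2 / (a₂ - a₁)) * X + C (-(a₁ + a₂) / (a₂ - a₁))))
    (chebyshev_T_sq_sub_one n)
  simp only [sub_comp, pow_comp, mul_comp, one_comp, X_comp] at h
  rw [segmentChebyshev, h, mul_pow, ← mul_assoc]
  congr 1
  have hH : pellH (ℓ := 1) ![a₁, a₂] = (X - C a₁) * (X - C a₂) := by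
    change ∏ j : Fin 2, _ = _
    simp [Fin.prod_univ_two]
  rw [hH]
  refine Polynomial.funext fun z => ?_
  simp only [eval_mul, eval_sub, eval_pow, eval_add, eval_X, eval_C, eval_one]
  field_simp
  ring

theorem isJordanArc_segment (hne : a₁ ≠ a₂) : IsJordanArc (segment ℝ a₁ a₂) a₁ a₂ := by
  refine ⟨Path.segment a₁ a₂, fun s t hst => ?_, Path.range_segment a₁ a₂⟩
  rw [Path.segment_apply, Path.segment_apply] at hst
  exact Subtype.ext (AffineMap.lineMap_injective ℝ hne hst)

theorem eq_segmentChebyshev_of_isJordanArc {P : ℂ[X]} (hn : 1 ≤ n) (hP : P.natDegree = n)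
    (hne : a₁ ≠ a₂) (h : IsJordanArc (polyInvImage P) a₁ a₂) :
    P = segmentChebyshev n a₁ a₂ ∨ P = -segmentChebyshev n a₁ a₂ := by
  obtain ⟨U, -, -, hU⟩ := satisfiesPell_of_isJordanArc (by omega) hne h
  obtain ⟨V, hV⟩ := pell_segmentChebyshev hn hne
  exact pell_unique (by rw [pellH_natDegree]; norm_num)
    (by rw [hP, natDegree_segmentChebyshev hne]) (by omega) hU hV

theorem polyInvImage_eq_segment {P : ℂ[X]} (hn : 1 ≤ n) (hne : a₁ ≠ a₂)
    (h : P = segmentChebyshev n a₁ a₂ ∨ P = -segmentChebyshev n a₁ a₂) :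
    polyInvImage P = segment ℝ a₁ a₂ := by
  rcases h with rfl | rfl
  · exact polyInvImage_segmentChebyshev hn hne
  · rw [polyInvImage_neg, polyInvImage_segmentChebyshev hn hne]

end

theorem corollary1 (n : ℕ) (hn : 1 ≤ n) (P : ℂ[X]) (hP : P.natDegree = n) :
    (∀ a₁ a₂ : ℂ, a₁ ≠ a₂ →
      (IsJordanArc (polyInvImage P) a₁ a₂ ↔
        ((∀ z : ℂ, P.eval z =
            (Chebyshev.T ℂ (n : ℤ)).eval ((2 * z - a₁ - a₂) / (a₂ - a₁))) ∨
         (∀ z : ℂ, P.eval z =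
            -(Chebyshev.T ℂ (n : ℤ)).eval ((2 * z - a₁ - a₂) / (a₂ - a₁))))) ∧
      (IsJordanArc (polyInvImage P) a₁ a₂ → polyInvImage P = segment ℝ a₁ a₂)) ∧
    (∀ (ℓ : ℕ) (a : Fin (2 * ℓ) → ℝ), 1 ≤ ℓ → StrictMono a →
      (polyInvImage P = intervalUnion a ↔
        SatisfiesPell P (fun j => (a j : ℂ)))) := by
  refine ⟨fun a₁ a₂ hne => ?_, fun ℓ a hℓ ha =>
    ⟨satisfiesPell_of_polyInvImage_eq (by omega) hℓ ha, polyInvImage_eq_of_satisfiesPell ha hℓ⟩⟩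
  simp only [← eval_segmentChebyshev, ← eval_neg]
  refine ⟨⟨fun h => ?_, fun h => ?_⟩, fun h =>
    polyInvImage_eq_segment hn hne (eq_segmentChebyshev_of_isJordanArc hn hP hne h)⟩
  · rcases eq_segmentChebyshev_of_isJordanArc hn hP hne h with rfl | rfl
    · exact Or.inl fun z => rfl
    · exact Or.inr fun z => rfl
  · rw [polyInvImage_eq_segment hn hne (h.imp Polynomial.funext Polynomial.funext)]
    exact isJordanArc_segment hne
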